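/- Let $X$ be a compact metrizable space, with a compatible metric $d$, and let $\mathrm{TDS}(X)$ be the space of all continuous maps $T\colon X\to X$ with the topology of uniform convergence. A system $(Y,S)$ ($Y$ compact metrizable, $S\colon Y\to Y$ continuous) is a factor of $(X,T)$ if there is a continuous surjection $\varphi\colon X\to Y$ with $\varphi\circ T=S\circ\varphi$. For an open cover $\mathcal U$ of $Y$ let $N(\mathcal U)$ be the smallest cardinality of a subcover, and put $$h_{\mathrm{top}}(Y,S)=\sup_{\mathcal U}\ \lim_{n\to\infty}\frac1n\log N\Big(\bigvee_{m=1}^n S^{-m}(\mathcal U)\Big),$$ the supremum being over all open covers of $Y$. Let $\mathrm{CPE}(X)$ be the set of all $T\in\mathrm{TDS}(X)$ with completely positive entropy, i.e. such that every factor $(Y,S)$ of $(X,T)$ with more than one point has $h_{\mathrm{top}}(Y,S)>0$. Let $\mathrm{Shad}(X)$ be the set of all $T\in\mathrm{TDS}(X)$ with the shadowing property, i.e. such that for every $\varepsilon>0$ there is $\delta>0$ such that for every sequence $(x_n)_{n\ge0}$ in $X$ with $d(T(x_n),x_{n+1})\le\delta$ for all $n\ge 0$ there is $y\in X$ with $d(x_n,T^n(y))\le\varepsilon$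 for all $n\ge 0$. Then $\mathrm{Shad}(X)\cap\mathrm{CPE}(X)$ is a Borel subset of $\mathrm{TDS}(X)$. -/

import Mathlib

namespace LocalEntropy

universe u

section Entropy

/-- `𝒰` is an open cover of the space. -/
def IsOpenCover {X : Type u} [TopologicalSpace X] (𝒰 : Set (Set X)) : Prop :=
  (∀ U ∈ 𝒰, IsOpen U) ∧ ⋃₀ 𝒰 = Set.univ

/-- The join `𝒰 ∨ 𝒱 = {U ∩ V : U ∈ 𝒰, V ∈ 𝒱}`. -/
def coverJoin {X : Type u} (𝒰 𝒱 : Set (Set X)) : Set (Set X) :=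
  Set.image2 (fun U V => U ∩ V) 𝒰 𝒱

/-- The pulled-back family `f⁻¹(𝒰) = {f⁻¹(U) : U ∈ 𝒰}`. -/
def coverPreimage {X : Type u} (f : X → X) (𝒰 : Set (Set X)) : Set (Set X) :=
  (fun U => f ⁻¹' U) '' 𝒰

/-- The iterated join `T⁻¹(𝒰) ∨ T⁻²(𝒰) ∨ ⋯ ∨ T⁻ⁿ(𝒰)`; the empty join is the trivial cover. -/
def dynJoin {X : Type u} (T : X → X) (𝒰 : Set (Set X)) : ℕ → Set (Set X)
  | 0 => {Set.univ}
  | n + 1 => coverJoin (dynJoin T 𝒰 n) (coverPreimage (T^[n + 1]) 𝒰)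

/-- `N(𝒰)`, the smallest cardinality of a subcover of `𝒰`. It is used for open covers of compact
spaces, which do have finite subcovers. -/
noncomputable def minSubcover {X : Type u} (𝒰 : Set (Set X)) : ℕ :=
  sInf (Set.ncard '' {𝒱 : Set (Set X) | 𝒱 ⊆ 𝒰 ∧ 𝒱.Finite ∧ ⋃₀ 𝒱 = Set.univ})

/-- `h_top(X, T, 𝒰)`, the limit of `(1 / n) log N(T⁻¹(𝒰) ∨ ⋯ ∨ T⁻ⁿ(𝒰))`. It is written as an upper
limit, and `tendsto_coverEntropy` below shows that it is a limit. -/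
noncomputable def coverEntropy {X : Type u} (T : X → X) (𝒰 : Set (Set X)) : EReal :=
  Filter.limsup
    (fun n : ℕ => ((Real.log (minSubcover (dynJoin T 𝒰 n)) / n : ℝ) : EReal)) Filter.atTop

/-- The topological entropy `h_top(X, T)`, the supremum of `h_top(X, T, 𝒰)` over all open covers. -/
noncomputable def topEntropy {X : Type u} [TopologicalSpace X] (T : X → X) : EReal :=
  ⨆ (𝒰 : Set (Set X)) (_ : IsOpenCover 𝒰), coverEntropy T 𝒰

/-- `𝒰` has a finite subcover. -/
def HasFinSubcover {X : Type u} (𝒰 : Set (Set X)) : Prop :=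
  ∃ 𝒱 : Set (Set X), 𝒱 ⊆ 𝒰 ∧ 𝒱.Finite ∧ ⋃₀ 𝒱 = Set.univ

theorem HasFinSubcover.exists_min {X : Type u} {𝒰 : Set (Set X)} (h : HasFinSubcover 𝒰) :
    ∃ 𝒱 : Set (Set X), 𝒱 ⊆ 𝒰 ∧ 𝒱.Finite ∧ ⋃₀ 𝒱 = Set.univ ∧ 𝒱.ncard = minSubcover 𝒰 := by
  obtain ⟨𝒱, h1, h2, h3⟩ := h
  obtain ⟨𝒲, ⟨a, b, c⟩, d⟩ := Nat.sInf_mem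
    (s := Set.ncard '' {𝒱 : Set (Set X) | 𝒱 ⊆ 𝒰 ∧ 𝒱.Finite ∧ ⋃₀ 𝒱 = Set.univ})
    ⟨_, 𝒱, ⟨h1, h2, h3⟩, rfl⟩
  exact ⟨𝒲, a, b, c, d⟩

theorem minSubcover_le {X : Type u} {𝒰 𝒱 : Set (Set X)} (h1 : 𝒱 ⊆ 𝒰) (h2 : 𝒱.Finite)
    (h3 : ⋃₀ 𝒱 = Set.univ) : minSubcover 𝒰 ≤ 𝒱.ncard :=
  Nat.sInf_le ⟨𝒱, ⟨h1, h2, h3⟩, rfl⟩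

theorem IsOpenCover.hasFinSubcover {X : Type u} [TopologicalSpace X] [CompactSpace X]
    {𝒰 : Set (Set X)} (h : IsOpenCover 𝒰) : HasFinSubcover 𝒰 := by
  obtain ⟨t, ht⟩ := isCompact_univ.elim_finite_subcover (fun U : 𝒰 => (U : Set X))
    (fun U => h.1 U U.2) (by rw [← Set.sUnion_eq_iUnion, h.2])
  refine ⟨Subtype.val '' (t : Set 𝒰), ?_, t.finite_toSet.image _, ?_⟩
  · rintro _ ⟨U, -, rfl⟩
    exact U.2
  · refine Set.eq_univ_of_forall fun x => ?_
    obtain ⟨U, hU, hx⟩ := Set.mem_iUnion₂.1 (ht (Set.mem_univ x))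
    exact ⟨U, ⟨U, hU, rfl⟩, hx⟩

theorem join_bound {X : Type u} {𝒰 𝒱 : Set (Set X)} (hU : HasFinSubcover 𝒰)
    (hV : HasFinSubcover 𝒱) : HasFinSubcover (coverJoin 𝒰 𝒱) ∧
      minSubcover (coverJoin 𝒰 𝒱) ≤ minSubcover 𝒰 * minSubcover 𝒱 := by
  obtain ⟨A, a1, a2, a3, a4⟩ := hU.exists_min
  obtain ⟨B, b1, b2, b3, b4⟩ := hV.exists_min
  have h1 : coverJoin A B ⊆ coverJoin 𝒰 𝒱 := Set.image2_subset a1 b1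
  have h2 : (coverJoin A B).Finite := a2.image2 _ b2
  have h3 : ⋃₀ coverJoin A B = Set.univ := by
    refine Set.eq_univ_of_forall fun x => ?_
    obtain ⟨U, hU, hx⟩ := Set.mem_sUnion.1 (a3 ▸ Set.mem_univ x)
    obtain ⟨V, hV, hy⟩ := Set.mem_sUnion.1 (b3 ▸ Set.mem_univ x)
    exact ⟨U ∩ V, ⟨U, hU, V, hV, rfl⟩, hx, hy⟩
  refine ⟨⟨_, h1, h2, h3⟩, (minSubcover_le h1 h2 h3).trans ?_⟩
  rw [← a4, ← b4, ← Set.ncard_prod, coverJoin, ← Set.image_prod]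
  exact Set.ncard_image_le (a2.prod b2)

theorem preimage_bound {X : Type u} (f : X → X) {𝒰 : Set (Set X)} (hU : HasFinSubcover 𝒰) :
    HasFinSubcover (coverPreimage f 𝒰) ∧ minSubcover (coverPreimage f 𝒰) ≤ minSubcover 𝒰 := by
  obtain ⟨A, a1, a2, a3, a4⟩ := hU.exists_min
  have h1 : coverPreimage f A ⊆ coverPreimage f 𝒰 := Set.image_mono a1
  have h2 : (coverPreimage f A).Finite := a2.image _
  have h3 : ⋃₀ coverPreimage f A = Set.univ := by
    refine Set.eq_univ_of_forall fun x => ?_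
    obtain ⟨U, hU, hx⟩ := Set.mem_sUnion.1 (a3 ▸ Set.mem_univ (f x))
    exact ⟨f ⁻¹' U, ⟨U, hU, rfl⟩, hx⟩
  refine ⟨⟨_, h1, h2, h3⟩, (minSubcover_le h1 h2 h3).trans ?_⟩
  rw [← a4]
  exact Set.ncard_image_le a2

theorem hasFinSubcover_dynJoin {X : Type u} (T : X → X) {𝒰 : Set (Set X)}
    (hU : HasFinSubcover 𝒰) (n : ℕ) : HasFinSubcover (dynJoin T 𝒰 n) := by
  induction n with
  | zero => exact ⟨{Set.univ}, subset_rfl, Set.finite_singleton _, by simp⟩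
  | succ n ih => exact (join_bound ih (preimage_bound _ hU).1).1

theorem dynJoin_add {X : Type u} (T : X → X) (𝒰 : Set (Set X)) (m n : ℕ) :
    dynJoin T 𝒰 (m + n) = coverJoin (dynJoin T 𝒰 m) (coverPreimage (T^[m]) (dynJoin T 𝒰 n)) := by
  induction n with
  | zero => simp [dynJoin, coverJoin, coverPreimage]
  | succ n ih =>
    rw [← add_assoc, dynJoin, ih, dynJoin]
    simp only [coverJoin, coverPreimage]
    rw [Set.image_image2_distrib (g := fun U => T^[m] ⁻¹' U) (f' := fun U V => U ∩ V)
      (g₁ := fun U => T^[m] ⁻¹' U) (g₂ := fun U => T^[m] ⁻¹' U) (fun _ _ => rfl), Set.image_image,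
      Set.image2_assoc (f := fun U V : Set X => U ∩ V) (g := fun U V => U ∩ V)
        (f' := fun U V => U ∩ V) (g' := fun U V => U ∩ V)
        (fun _ _ _ => Set.inter_assoc _ _ _)]
    congr 3 with U
    rw [← Set.preimage_comp, ← Function.iterate_add, add_comm (n + 1) m, add_assoc]

/-- The limit in the definition of the entropy with respect to a cover exists. -/
theorem tendsto_coverEntropy {X : Type u} [TopologicalSpace X] [CompactSpace X] (T : X → X)
    {𝒰 : Set (Set X)} (hU : IsOpenCover 𝒰) :
    Filter.Tendsto (fun n : ℕ => ((Real.log (minSubcover (dynJoin T 𝒰 n)) / n : ℝ) : EReal))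
      Filter.atTop (nhds (coverEntropy T 𝒰)) := by
  have hs : Subadditive fun n : ℕ => Real.log (minSubcover (dynJoin T 𝒰 n)) := by
    intro m n
    have hm := hasFinSubcover_dynJoin T hU.hasFinSubcover m
    have hn := hasFinSubcover_dynJoin T hU.hasFinSubcover n
    have hmn := hasFinSubcover_dynJoin T hU.hasFinSubcover (m + n)
    have hle : minSubcover (dynJoin T 𝒰 (m + n)) ≤
        minSubcover (dynJoin T 𝒰 m) * minSubcover (dynJoin T 𝒰 n) := by
      rw [dynJoin_add]
      have hp := preimage_bound (T^[m]) hn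
      exact (join_bound hm hp.1).2.trans (Nat.mul_le_mul_left _ hp.2)
    rcases Nat.eq_zero_or_pos (minSubcover (dynJoin T 𝒰 (m + n))) with h0 | h0
    · simp only [h0, Nat.cast_zero, Real.log_zero]
      exact add_nonneg (Real.log_natCast_nonneg _) (Real.log_natCast_nonneg _)
    · have hpos := h0.trans_le hle
      have h1 := Nat.pos_of_mul_pos_right hpos
      have h2 := Nat.pos_of_mul_pos_left hpos
      show Real.log _ ≤ Real.log _ + Real.log _
      rw [← Real.log_mul (by positivity) (by positivity)]
      exact Real.log_le_log (by positivity) (by exact_mod_cast hle)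
  have hb : BddBelow (Set.range fun n : ℕ =>
      Real.log (minSubcover (dynJoin T 𝒰 n)) / n) :=
    ⟨0, by rintro _ ⟨n, rfl⟩; exact div_nonneg (Real.log_natCast_nonneg _) (Nat.cast_nonneg _)⟩
  have h := (continuous_coe_real_ereal.tendsto _).comp (hs.tendsto_lim hb)
  have h' : coverEntropy T 𝒰 = ((hs.lim : ℝ) : EReal) := h.limsup_eq
  rw [h']
  exact h

end Entropy

section Dynamics

/-- `φ` is a factor map from `(X, T)` onto `(Y, S)`. -/
def IsFactorMap {X Y : Type u} [TopologicalSpace X] [TopologicalSpace Y]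
    (T : C(X, X)) (S : C(Y, Y)) (φ : C(X, Y)) : Prop :=
  Function.Surjective φ ∧ ∀ x, φ (T x) = S (φ x)

/-- `(X, T)` has completely positive entropy: every factor `(Y, S)` with more than one point has
positive topological entropy. As a continuous image of the compact space `X`, each factor is
homeomorphic to a quotient of `X`, so `Y` may be taken in the universe of `X`. -/
def HasCPE {X : Type u} [TopologicalSpace X] (T : C(X, X)) : Prop :=
  ∀ (Y : Type u) [TopologicalSpace Y] [CompactSpace Y] [TopologicalSpace.MetrizableSpace Y]
    [Nontrivial Y] (S : C(Y, Y)) (φ : C(X, Y)), IsFactorMap T S φ → 0 < topEntropy S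

/-- `x` is a `δ`-pseudo-orbit of `T`. -/
def IsPseudoOrbit {X : Type u} [MetricSpace X] (T : X → X) (δ : ℝ) (x : ℕ → X) : Prop :=
  ∀ n, dist (T (x n)) (x (n + 1)) ≤ δ

/-- `(X, T)` has the shadowing property. -/
def HasShadowing {X : Type u} [MetricSpace X] (T : X → X) : Prop :=
  ∀ ε : ℝ, 0 < ε → ∃ δ : ℝ, 0 < δ ∧ ∀ x : ℕ → X, IsPseudoOrbit T δ x →
    ∃ y : X, ∀ n, dist (x n) (T^[n] y) ≤ ε

/-- `CPE(X)`, as a subset of the space `C(X, X)` of continuous self-maps of `X`. -/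
def CPE (X : Type u) [TopologicalSpace X] : Set C(X, X) :=
  {T | HasCPE T}

/-- `Shad(X)`, as a subset of the space `C(X, X)` of continuous self-maps of `X`. -/
def Shad (X : Type u) [MetricSpace X] : Set C(X, X) :=
  {T | HasShadowing T}

end Dynamics

end LocalEntropy

open Filter Topology Set

namespace LocalEntropy

universe u

/-! ### Itineraries and subcovers of iterated joins -/

section Itineraries

/-! Completely positive entropy quantifies over all factors, which gives no Borel description
directly. Under shadowing, however, it is equivalent to chain mixing, and both shadowing and chain
mixing are countable combinations of closed conditions on `T`.

Completely positive entropy always implies chain mixing. The set of points reachable from `x` by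
`δ`-chains is an open trapping region. A proper trapping region yields a nontrivial factor in which
every orbit waits near one point and is then absorbed by a fixed point; itineraries grow linearly,
so its entropy is zero (`HasCPE.eq_univ_of_trapping`). Hence any two points are joined by chains. If
the lengths of the chains from `x` to itself had gcd `g > 1`, chain length mod `g` would be a factor
map onto a finite rotation; so the gcd is 1 and all large lengths occur.

Conversely, chains of one fixed length `k` between two points can be concatenated in any order, and
shadowing turns them into true orbits. In a nontrivial factor this gives two disjoint closed sets
visited in arbitrary order at multiples of `k`, so the entropy is at least `log 2 / k`. -/

/-- The points whose iterates at the times `1, …, n` lie in the prescribed sets `w 1, …, w n`. -/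
def itineraryCell {Y : Type u} (S : Y → Y) (w : ℕ → Set Y) (n : ℕ) : Set Y :=
  {y | ∀ m, 1 ≤ m → m ≤ n → S^[m] y ∈ w m}

theorem itineraryCell_mem_dynJoin {Y : Type u} (S : Y → Y) {𝒰 : Set (Set Y)} {w : ℕ → Set Y}
    (hw : ∀ m, w m ∈ 𝒰) (n : ℕ) : itineraryCell S w n ∈ dynJoin S 𝒰 n := by
  induction n with
  | zero =>
    refine Set.mem_singleton_iff.2 (Set.eq_univ_of_forall fun y m h1 h2 => ?_)
    omega
  | succ n ih =>
    refine ⟨_, ih, _, ⟨w (n + 1), hw _, rfl⟩, ?_⟩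
    ext y
    constructor
    · rintro ⟨h1, h2⟩ m hm hmn
      rcases Nat.lt_or_ge n m with h | h
      · obtain rfl : m = n + 1 := by omega
        exact h2
      · exact h1 m hm h
    · intro h
      exact ⟨fun m hm hmn => h m hm (by omega), h (n + 1) (by omega) le_rfl⟩

theorem exists_subset_preimage_of_mem_dynJoin {Y : Type u} {S : Y → Y} {𝒰 : Set (Set Y)} {n : ℕ}
    {V : Set Y} (hV : V ∈ dynJoin S 𝒰 n) {m : ℕ} (h1 : 1 ≤ m) (hm : m ≤ n) :
    ∃ U ∈ 𝒰, V ⊆ S^[m] ⁻¹' U := by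
  induction n generalizing V with
  | zero => omega
  | succ n ih =>
    obtain ⟨A, hA, _, ⟨U, hU, rfl⟩, rfl⟩ := hV
    rcases Nat.lt_or_ge n m with h | h
    · obtain rfl : m = n + 1 := by omega
      exact ⟨U, hU, Set.inter_subset_right⟩
    · obtain ⟨U', hU', hs⟩ := ih hA h
      exact ⟨U', hU', Set.inter_subset_left.trans hs⟩

/-- Finitely many itineraries that describe all points bound the size of a subcover. -/
theorem minSubcover_dynJoin_le {Y : Type u} (S : Y → Y) {𝒰 : Set (Set Y)} {n : ℕ}
    {W : Set (ℕ → Set Y)} (hf : W.Finite) (hW : ∀ w ∈ W, ∀ m, w m ∈ 𝒰)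
    (hc : ∀ y, ∃ w ∈ W, y ∈ itineraryCell S w n) :
    minSubcover (dynJoin S 𝒰 n) ≤ W.ncard := by
  refine (minSubcover_le (𝒱 := (fun w => itineraryCell S w n) '' W) ?_ (hf.image _) ?_).trans
    (Set.ncard_image_le hf)
  · rintro _ ⟨w, hw, rfl⟩
    exact itineraryCell_mem_dynJoin S (hW w hw) n
  · refine Set.eq_univ_of_forall fun y => ?_
    obtain ⟨w, hw, hy⟩ := hc y
    exact ⟨_, ⟨w, hw, rfl⟩, hy⟩

end Itineraries

/-! ### Criteria for zero entropy -/

section ZeroEntropy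

theorem topEntropy_nonpos_of_linear_growth {Y : Type u} [TopologicalSpace Y] (S : Y → Y)
    (h : ∀ 𝒰 : Set (Set Y), IsOpenCover 𝒰 →
      ∃ C : ℕ, ∀ n, minSubcover (dynJoin S 𝒰 n) ≤ C * (n + 1)) :
    topEntropy S ≤ 0 := by
  refine iSup₂_le fun 𝒰 h𝒰 => ?_
  obtain ⟨C, hC⟩ := h 𝒰 h𝒰
  set D : ℝ := C + 1 with hD
  have hDpos : 0 < D := by positivity
  have h1 : Tendsto (fun n : ℕ => D * ((n : ℝ) + 1)) atTop atTop :=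
    (tendsto_natCast_atTop_atTop.atTop_add tendsto_const_nhds).const_mul_atTop hDpos
  -- The factor 2 pays for replacing the denominator `n` by `n + 1`, since `n + 1 ≤ 2 * n` for `n ≥
  -- 1`.
  have h2 : Tendsto (fun n : ℕ => 2 * D * (Real.log (D * ((n : ℝ) + 1)) / (D * ((n : ℝ) + 1))))
      atTop (𝓝 0) := by
    have := (Real.isLittleO_log_id_atTop.tendsto_div_nhds_zero.comp h1).const_mul (2 * D)
    simpa using this
  have h3 : Tendsto (fun n : ℕ =>
      ((2 * D * (Real.log (D * ((n : ℝ) + 1)) / (D * ((n : ℝ) + 1))) : ℝ) : EReal))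
      atTop (𝓝 ((0 : ℝ) : EReal)) :=
    (continuous_coe_real_ereal.tendsto _).comp h2
  have h4 := h3.limsup_eq
  rw [EReal.coe_zero] at h4
  rw [← h4]
  refine limsup_le_limsup ?_
  filter_upwards [eventually_ge_atTop 1] with n hn
  rw [EReal.coe_le_coe_iff]
  have hn' : (1 : ℝ) ≤ n := by exact_mod_cast hn
  have hle : Real.log (minSubcover (dynJoin S 𝒰 n)) ≤ Real.log (D * ((n : ℝ) + 1)) := by
    have hb : ((minSubcover (dynJoin S 𝒰 n) : ℕ) : ℝ) ≤ D * ((n : ℝ) + 1) := by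
      have : ((minSubcover (dynJoin S 𝒰 n) : ℕ) : ℝ) ≤ C * ((n : ℝ) + 1) := by
        exact_mod_cast hC n
      refine this.trans ?_
      gcongr
      rw [hD]; linarith
    rcases Nat.eq_zero_or_pos (minSubcover (dynJoin S 𝒰 n)) with h0 | h0
    · rw [h0, Nat.cast_zero, Real.log_zero]
      refine Real.log_nonneg ?_
      have : (0 : ℝ) ≤ C := by positivity
      nlinarith
    · exact Real.log_le_log (by exact_mod_cast h0) hb
  have hlog : 0 ≤ Real.log (D * ((n : ℝ) + 1)) := (Real.log_natCast_nonneg _).trans hle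
  rw [div_le_iff₀ (by linarith)]
  refine hle.trans ?_
  have : 2 * D * (Real.log (D * ((n : ℝ) + 1)) / (D * ((n : ℝ) + 1))) * n =
      Real.log (D * ((n : ℝ) + 1)) * (2 * n / (n + 1)) := by
    field_simp
  rw [this]
  refine le_mul_of_one_le_right hlog ?_
  rw [le_div_iff₀ (by linarith)]
  linarith

theorem topEntropy_nonpos_of_finite {Y : Type u} [TopologicalSpace Y] [Finite Y] (S : Y → Y) :
    topEntropy S ≤ 0 := by
  refine topEntropy_nonpos_of_linear_growth S fun 𝒰 h𝒰 => ?_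
  have hex : ∀ y : Y, ∃ U ∈ 𝒰, y ∈ U := fun y => Set.mem_sUnion.1 (h𝒰.2 ▸ Set.mem_univ y)
  choose Φ hΦ hyΦ using hex
  set W : Set (ℕ → Set Y) := Set.range fun y m => Φ (S^[m] y)
  refine ⟨W.ncard, fun n => ?_⟩
  refine (minSubcover_dynJoin_le S (W := W) (Set.finite_range _) ?_ fun y =>
    ⟨_, ⟨y, rfl⟩, fun m _ _ => hyΦ _⟩).trans (Nat.le_mul_of_pos_right _ (Nat.succ_pos n))
  rintro _ ⟨y, rfl⟩ m
  exact hΦ _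

/-- If every orbit that leaves a neighbourhood of `q` reaches the fixed point `p` after a time that
depends only on the neighbourhood, then the entropy vanishes. -/
theorem topEntropy_nonpos_of_absorbing {Y : Type u} [TopologicalSpace Y] (S : Y → Y) (p q : Y)
    (hp : S p = p) (h : ∀ W : Set Y, IsOpen W → q ∈ W → ∃ K : ℕ, ∀ y, y ∉ W → S^[K] y = p)
    [CompactSpace Y] : topEntropy S ≤ 0 := by
  classical
  refine topEntropy_nonpos_of_linear_growth S fun 𝒰 h𝒰 => ?_
  obtain ⟨𝒱, h𝒱, hfin, hcov⟩ := h𝒰.hasFinSubcover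
  have hex : ∀ y : Y, ∃ U ∈ 𝒱, y ∈ U := fun y => Set.mem_sUnion.1 (hcov ▸ Set.mem_univ y)
  choose Φ hΦ hyΦ using hex
  obtain ⟨K, hK⟩ := h (Φ q) (h𝒰.1 _ (h𝒱 (hΦ q))) (hyΦ q)
  -- Itineraries of points outside `Φ q`: they sit at `p` from time `K` on, so only the first `K`
  -- letters are free.
  set J : Set (ℕ → Set Y) := {w | (∀ m, w m ∈ 𝒱) ∧ ∀ m, K ≤ m → w m = Φ p} with hJ
  have hJfin : J.Finite := by
    have : Finite 𝒱 := hfin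
    refine (Set.finite_range fun (f : Fin K → 𝒱) (m : ℕ) =>
      if hm : m < K then (f ⟨m, hm⟩ : Set Y) else Φ p).subset ?_
    rintro w ⟨hw1, hw2⟩
    refine ⟨fun i => ⟨w i, hw1 _⟩, ?_⟩
    funext m
    by_cases hm : m < K
    · simp [hm]
    · simp [hm, hw2 m (by omega)]
  have hJmem : ∀ y, y ∉ Φ q → (fun m => Φ (S^[m] y)) ∈ J := by
    refine fun y hy => ⟨fun m => hΦ _, fun m hm => ?_⟩
    have : S^[m] y = p := by
      obtain ⟨j, rfl⟩ := Nat.exists_eq_add_of_le hm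
      rw [add_comm, Function.iterate_add_apply, hK y hy, Function.iterate_fixed hp]
    simp only [this]
  set g : ℕ × (ℕ → Set Y) → ℕ → Set Y := fun a m => if m < a.1 then Φ q else a.2 (m - a.1) with hg
  refine ⟨1 + J.ncard, fun n => ?_⟩
  set W : Set (ℕ → Set Y) := insert (fun _ => Φ q) (g '' ((Finset.range (n + 1) : Set ℕ) ×ˢ J))
  have hprod : ((Finset.range (n + 1) : Set ℕ) ×ˢ J).Finite := (Finset.finite_toSet _).prod hJfin
  have hWfin : W.Finite := (hprod.image g).insert _
  refine (minSubcover_dynJoin_le S (W := W) hWfin ?_ fun y => ?_).trans ?_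
  · rintro _ (rfl | ⟨⟨j, w⟩, ⟨-, hw⟩, rfl⟩) m
    · exact h𝒱 (hΦ q)
    · simp only [hg]
      split_ifs
      · exact h𝒱 (hΦ q)
      · exact h𝒱 (hw.1 _)
  · by_cases hy : ∀ m, m ≤ n → S^[m] y ∈ Φ q
    · exact ⟨_, Set.mem_insert _ _, fun m _ hm => hy m hm⟩
    · push Not at hy
      have hmin := fun m => @Nat.find_min _ _ hy m
      obtain ⟨hj1, hj2⟩ := Nat.find_spec hy
      set j := Nat.find hy
      refine ⟨g (j, fun m => Φ (S^[m] (S^[j] y))), Set.mem_insert_of_mem _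
        ⟨_, ⟨?_, hJmem _ hj2⟩, rfl⟩, fun m _ hm => ?_⟩
      · simpa using Nat.lt_succ_of_le hj1
      · simp only [hg]
        split_ifs with hmj
        · by_contra hcon
          exact hmin m hmj ⟨hm, hcon⟩
        · rw [← Function.iterate_add_apply, Nat.sub_add_cancel (by omega)]
          exact hyΦ _
  · refine (Set.ncard_insert_le _ _).trans ?_
    have h1 := (Set.ncard_image_le (f := g) hprod)
    rw [Set.ncard_prod, Set.ncard_coe_finset, Finset.card_range] at h1
    nlinarith

end ZeroEntropy

/-! ### A criterion for positive entropy -/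

section PositiveEntropy

/-- Two closed sets that can be visited in any prescribed order at the multiples of `k` give
positive entropy. -/
theorem topEntropy_pos_of_independent {Y : Type u} [TopologicalSpace Y] [CompactSpace Y]
    (S : Y → Y) (A : Bool → Set Y) (hA : ∀ b, IsClosed (A b)) (hd : Disjoint (A true) (A false))
    {k : ℕ} (hk : 1 ≤ k) (hind : ∀ s : ℕ → Bool, ∃ y, ∀ i, 1 ≤ i → S^[k * i] y ∈ A (s i)) :
    0 < topEntropy S := by
  classical
  set 𝒰 : Set (Set Y) := Set.range fun b => (A b)ᶜ with h𝒰
  have hcov : IsOpenCover 𝒰 := by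
    refine ⟨?_, Set.eq_univ_of_forall fun y => ?_⟩
    · rintro _ ⟨b, rfl⟩
      exact (hA b).isOpen_compl
    · by_cases hy : y ∈ A true
      · exact ⟨_, ⟨false, rfl⟩, Set.disjoint_left.1 hd hy⟩
      · exact ⟨_, ⟨true, rfl⟩, hy⟩
  have hcount : ∀ m : ℕ, 2 ^ m ≤ minSubcover (dynJoin S 𝒰 (k * m)) := by
    intro m
    obtain ⟨𝒱, h1, h2, h3, h4⟩ := (hasFinSubcover_dynJoin S hcov.hasFinSubcover (k * m)).exists_min
    rw [← h4]
    -- A cell records, at each time, a letter that it avoids. A cell containing a point with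
    -- itinerary `s` must record the opposite of `s`, so `2 ^ m` words need `2 ^ m` cells.
    have hcode : ∀ V : Set Y, ∃ t : Fin m → Bool, V ∈ 𝒱 →
        ∀ i : Fin m, V ⊆ S^[k * (i + 1)] ⁻¹' (A (t i))ᶜ := by
      intro V
      by_cases hV : V ∈ 𝒱
      · have : ∀ i : Fin m, ∃ b, V ⊆ S^[k * (i + 1)] ⁻¹' (A b)ᶜ := by
          intro i
          obtain ⟨_, ⟨b, rfl⟩, hb⟩ := exists_subset_preimage_of_mem_dynJoin (h1 hV)
            (m := k * (i + 1)) (Nat.mul_pos hk (Nat.succ_pos _)) (Nat.mul_le_mul_left _ i.2)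
          exact ⟨b, hb⟩
        choose t ht using this
        exact ⟨t, fun _ => ht⟩
      · exact ⟨fun _ => true, fun h => absurd h hV⟩
    choose t ht using hcode
    have hsurj : (Set.univ : Set (Fin m → Bool)) ⊆ (fun V i => !(t V i)) '' 𝒱 := by
      intro s _
      obtain ⟨y, hy⟩ := hind fun i => if h : i - 1 < m then s ⟨i - 1, h⟩ else true
      obtain ⟨V, hV, hyV⟩ := Set.mem_sUnion.1 (h3 ▸ Set.mem_univ y)
      refine ⟨V, hV, funext fun i => ?_⟩
      have ha := hy (i + 1) (by omega)
      have hb := ht V hV i hyV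
      simp only [Nat.add_sub_cancel, i.2, dif_pos] at ha
      have hne : s i ≠ t V i := fun h => hb (by rw [← h]; exact ha)
      exact (Bool.eq_not.2 hne).symm
    have := Set.ncard_le_ncard hsurj (h2.image _)
    rw [Set.ncard_univ, Nat.card_eq_fintype_card] at this
    simp only [Fintype.card_pi, Fintype.card_bool, Finset.prod_const, Finset.card_univ,
      Fintype.card_fin] at this
    exact this.trans (Set.ncard_image_le h2)
  have hsub : Tendsto (fun m : ℕ => k * m) atTop atTop :=
    tendsto_id.const_mul_atTop' (by omega)
  have hlim := (tendsto_coverEntropy S hcov).comp hsub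
  have hge : ((Real.log 2 / k : ℝ) : EReal) ≤ coverEntropy S 𝒰 := by
    refine ge_of_tendsto hlim ?_
    filter_upwards [eventually_ge_atTop 1] with m hm
    simp only [Function.comp_apply]
    rw [EReal.coe_le_coe_iff]
    have hm' : (0 : ℝ) < m := by exact_mod_cast hm
    have hk' : (0 : ℝ) < k := by exact_mod_cast hk
    have h1 : (m : ℝ) * Real.log 2 ≤ Real.log (minSubcover (dynJoin S 𝒰 (k * m))) := by
      rw [← Real.log_pow]
      exact Real.log_le_log (by positivity) (by exact_mod_cast hcount m)
    rw [Nat.cast_mul, div_le_div_iff₀ hk' (by positivity)]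
    nlinarith
  have hpos : (0 : EReal) < ((Real.log 2 / k : ℝ) : EReal) := by
    rw [← EReal.coe_zero, EReal.coe_lt_coe_iff]
    have hk' : (0 : ℝ) < k := by exact_mod_cast hk
    exact div_pos (Real.log_pos one_lt_two) hk'
  exact hpos.trans_le (hge.trans (le_iSup₂_of_le 𝒰 hcov le_rfl))

end PositiveEntropy

/-! ### Factors of zero entropy -/

section ZeroEntropyFactors

variable {X : Type u} [MetricSpace X] [CompactSpace X]

/-- A system with completely positive entropy has no proper trapping region. -/
theorem HasCPE.eq_univ_of_trapping {T : C(X, X)} (hT : HasCPE T) {U : Set X} (hU : IsOpen U)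
    (hne : U.Nonempty) (htrap : ∀ z ∈ closure U, T z ∈ U) : U = Set.univ := by
  by_contra hproper
  obtain ⟨x₀, hx₀⟩ := (Set.ne_univ_iff_exists_notMem U).1 hproper
  obtain ⟨x₁, hx₁⟩ := hne
  have hFc : IsClosed (T '' closure U) := (isClosed_closure.isCompact.image T.continuous).isClosed
  have hdisj : Disjoint (T '' closure U) Uᶜ := by
    rw [Set.disjoint_compl_right_iff_subset]
    rintro _ ⟨z, hz, rfl⟩
    exact htrap z hz
  obtain ⟨f, hf0, hf1, -⟩ := exists_continuous_zero_one_of_isClosed hFc hU.isClosed_compl hdisj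
  have hmemU : ∀ x ∈ U, ∀ n, T^[n] x ∈ U := by
    intro x hx n
    induction n with
    | zero => exact hx
    | succ n ih =>
      rw [Function.iterate_succ_apply']
      exact htrap _ (subset_closure ih)
  have hzero : ∀ x ∈ U, ∀ n, f (T^[n + 1] x) = 0 := by
    intro x hx n
    rw [Function.iterate_succ_apply']
    exact hf0 ⟨_, subset_closure (hmemU x hx n), rfl⟩
  have hexit : ∀ x, f x ≠ 1 → x ∈ U := by
    intro x hx
    by_contra h
    exact hx (hf1 h)
  have hiter : ∀ n, Continuous fun x => f (T^[n] x) := fun n =>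
    f.continuous.comp (T.continuous.iterate n)
  -- The image of `ψ` under the shift is the factor: orbits in `U` give the zero sequence after one
  -- step, and a coordinate different from 1 certifies that the orbit has entered `U`.
  set ψ : X → ℕ → ℝ := fun x n => f (T^[n] x) with hψ
  have hψc : Continuous ψ := continuous_pi hiter
  have hψT : ∀ x, (fun n => ψ x (n + 1)) = ψ (T x) := fun x => rfl
  let Y := ULift.{u} (Set.range ψ)
  have : CompactSpace (Set.range ψ) := isCompact_iff_compactSpace.1 (isCompact_range hψc)
  have : TopologicalSpace.MetrizableSpace Y := IsEmbedding.uliftDown.metrizableSpace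
  let φ : C(X, Y) := ⟨fun x => ⟨⟨ψ x, x, rfl⟩⟩,
    continuous_uliftUp.comp (hψc.subtype_mk _)⟩
  have hφsurj : Function.Surjective φ := by
    rintro ⟨⟨_, x, rfl⟩⟩
    exact ⟨x, rfl⟩
  have hφext : ∀ x y, ψ x = ψ y → φ x = φ y := fun x y h =>
    ULift.down_injective (Subtype.ext h)
  let S : C(Y, Y) := ⟨fun y => ⟨⟨fun n => y.down.1 (n + 1), by
    obtain ⟨⟨_, x, rfl⟩⟩ := y
    exact ⟨T x, (hψT x).symm⟩⟩⟩, by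
    refine continuous_uliftUp.comp (Continuous.subtype_mk (continuous_pi fun n => ?_) _)
    exact (continuous_apply (n + 1)).comp (continuous_subtype_val.comp continuous_uliftDown)⟩
  have hφS : ∀ x, φ (T x) = S (φ x) := fun x => rfl
  have hφSn : ∀ n x, S^[n] (φ x) = φ (T^[n] x) := by
    intro n x
    exact ((show Function.Semiconj φ T S from hφS).iterate_right n x).symm
  have hψ0 : ∀ x ∈ U, ∀ n, ψ (T^[n + 1] x) = ψ (T x₁) := by
    intro x hx n
    funext m
    have h1 : ψ (T^[n + 1] x) m = 0 := by
      simp only [hψ]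
      rw [← Function.iterate_add_apply, ← add_assoc]
      exact hzero x hx _
    rw [h1]
    exact (hzero x₁ hx₁ m).symm
  have hnt : Nontrivial Y := by
    refine ⟨φ x₀, φ (T x₁), fun h => ?_⟩
    have h1 : ψ x₀ 0 = ψ (T x₁) 0 := congrFun (congrArg (fun y : Y => y.down.1) h) 0
    have h2 : ψ x₀ 0 = 1 := hf1 hx₀
    have h3 : ψ (T x₁) 0 = 0 := hzero x₁ hx₁ 0
    rw [h2, h3] at h1
    exact one_ne_zero h1
  have habs : ∀ W : Set Y, IsOpen W → (∀ x, (∀ n, ψ x n = 1) → φ x ∈ W) →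
      ∃ K : ℕ, ∀ y, y ∉ W → S^[K] y = φ (T x₁) := by
    intro W hW hq
    -- Compactness bounds the entrance time into `U` uniformly for all points whose image is outside
    -- `W`.
    have hcomp : IsCompact (φ ⁻¹' W)ᶜ := (hW.preimage φ.continuous).isClosed_compl.isCompact
    obtain ⟨t, ht⟩ := hcomp.elim_finite_subcover (fun n => {x | ψ x n ≠ 1})
      (fun n => isOpen_ne_fun (hiter n) continuous_const) (by
        intro x hx
        by_contra hcon
        simp only [Set.mem_iUnion, Set.mem_ofPred_eq, not_exists, not_not] at hcon
        exact hx (hq x hcon))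
    refine ⟨t.sup id + 1, fun y hy => ?_⟩
    obtain ⟨x, rfl⟩ := hφsurj y
    obtain ⟨n, hn, hx⟩ := Set.mem_iUnion₂.1 (ht hy)
    have hle : n ≤ t.sup id := Finset.le_sup (f := id) hn
    rw [hφSn]
    refine hφext _ _ ?_
    have := hψ0 _ (hexit _ hx) (t.sup id - n)
    rw [← Function.iterate_add_apply] at this
    rwa [show t.sup id - n + 1 + n = t.sup id + 1 by omega] at this
  have hfix : S (φ (T x₁)) = φ (T x₁) := by
    rw [← hφS]
    exact hφext _ _ (hψ0 x₁ hx₁ 1)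
  have hpos := hT Y S φ ⟨hφsurj, hφS⟩
  refine absurd hpos (not_lt.2 ?_)
  -- If the constant sequence 1 is not attained, there is no waiting point; absorption is then
  -- uniform and any point can serve as `q`.
  by_cases hq : ∃ x, ∀ n, ψ x n = 1
  · obtain ⟨x, hx⟩ := hq
    refine topEntropy_nonpos_of_absorbing S (φ (T x₁)) (φ x) hfix fun W hW hxW =>
      habs W hW fun x' hx' => ?_
    rwa [hφext x' x (funext fun n => (hx' n).trans (hx n).symm)]
  · exact topEntropy_nonpos_of_absorbing S (φ (T x₁)) (φ x₀) hfix fun W hW _ =>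
      habs W hW fun x hx => absurd ⟨x, hx⟩ hq

omit [CompactSpace X] in
/-- A system with completely positive entropy does not factor onto a nontrivial cyclic rotation. -/
theorem HasCPE.not_factor_zmod {T : C(X, X)} (hT : HasCPE T) {g : ℕ} (hg : 2 ≤ g) (κ : X → ZMod g)
    (hκ : Continuous κ) (hsurj : Function.Surjective κ) (hκT : ∀ x, κ (T x) = κ x + 1) : False := by
  have : Fact (1 < g) := ⟨hg⟩
  have : NeZero g := ⟨by omega⟩
  have : DiscreteTopology (ULift.{u} (ZMod g)) := inferInstance
  let S : C(ULift.{u} (ZMod g), ULift.{u} (ZMod g)) :=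
    ⟨fun y => ⟨y.down + 1⟩, continuous_of_discreteTopology⟩
  let φ : C(X, ULift.{u} (ZMod g)) := ⟨fun x => ⟨κ x⟩, continuous_uliftUp.comp hκ⟩
  have hfac : IsFactorMap T S φ :=
    ⟨fun y => (hsurj y.down).imp fun x hx => ULift.down_injective hx,
      fun x => ULift.down_injective (hκT x)⟩
  exact absurd (hT _ S φ hfac) (not_lt.2 (topEntropy_nonpos_of_finite S))

end ZeroEntropyFactors

/-! ### Chains, and chain mixing from completely positive entropy -/

section Chains

/-- `y` can be reached from `x` by a `δ`-chain with exactly `n` steps. -/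
def ChainReach {X : Type u} [MetricSpace X] (T : X → X) (δ : ℝ) : ℕ → X → X → Prop
  | 0, x, y => x = y
  | n + 1, x, y => ∃ z, ChainReach T δ n x z ∧ dist (T z) y < δ

variable {X : Type u} [MetricSpace X] {T : X → X} {δ : ℝ}

theorem ChainReach.trans {m n : ℕ} {x y z : X} (h1 : ChainReach T δ m x y)
    (h2 : ChainReach T δ n y z) : ChainReach T δ (m + n) x z := by
  induction n generalizing z with
  | zero =>
    obtain rfl : y = z := h2
    exact h1
  | succ n ih =>
    obtain ⟨w, hw, hd⟩ := h2
    exact ⟨w, ih hw, hd⟩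

theorem chainReach_one {x y : X} : ChainReach T δ 1 x y ↔ dist (T x) y < δ :=
  ⟨fun ⟨_, h, hd⟩ => h ▸ hd, fun h => ⟨x, rfl, h⟩⟩

theorem chainReach_succ_iff {n : ℕ} {x y : X} :
    ChainReach T δ (n + 1) x y ↔ ∃ z, dist (T x) z < δ ∧ ChainReach T δ n z y := by
  constructor
  · intro h
    induction n generalizing y with
    | zero => exact ⟨y, chainReach_one.1 h, rfl⟩
    | succ n ih =>
      obtain ⟨w, hw, hd⟩ := h
      obtain ⟨z, hz, hr⟩ := ih hw
      exact ⟨z, hz, w, hr, hd⟩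
  · rintro ⟨z, hz, hr⟩
    rw [add_comm]
    exact (chainReach_one.2 hz).trans hr

theorem isOpen_chainReach_right (n : ℕ) (x : X) : IsOpen {y | ChainReach T δ (n + 1) x y} := by
  have : {y | ChainReach T δ (n + 1) x y} =
      ⋃ z ∈ {z | ChainReach T δ n x z}, Metric.ball (T z) δ := by
    ext y
    simp [ChainReach, Metric.mem_ball, dist_comm y]
  rw [this]
  exact isOpen_biUnion fun z _ => Metric.isOpen_ball

theorem isOpen_chainReach_left (hT : Continuous T) (n : ℕ) (y : X) :
    IsOpen {x | ChainReach T δ (n + 1) x y} := by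
  have : {x | ChainReach T δ (n + 1) x y} =
      ⋃ z ∈ {z | ChainReach T δ n z y}, T ⁻¹' Metric.ball z δ := by
    ext x
    simp [chainReach_succ_iff, Metric.mem_ball, and_comm]
  rw [this]
  exact isOpen_biUnion fun z _ => Metric.isOpen_ball.preimage hT

theorem ChainReach.exists_seq {n : ℕ} {x y : X} (h : ChainReach T δ n x y) :
    ∃ c : ℕ → X, c 0 = x ∧ c n = y ∧ ∀ i < n, dist (T (c i)) (c (i + 1)) < δ := by
  induction n generalizing y with
  | zero => exact ⟨fun _ => x, rfl, h, fun i hi => by omega⟩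
  | succ n ih =>
    obtain ⟨z, hz, hd⟩ := h
    obtain ⟨c, h0, hn, hc⟩ := ih hz
    refine ⟨fun i => if i ≤ n then c i else y, by simp [h0], by simp, fun i hi => ?_⟩
    rcases Nat.lt_or_ge i n with h | h
    · simpa [h.le, Nat.succ_le_of_lt h] using hc i h
    · obtain rfl : i = n := by omega
      simpa [hn] using hd

variable [CompactSpace X]

/-- Compactness makes the number of steps uniform. The shift to `n + 1` is needed because
reachability in zero steps is equality, which is not an open condition. -/
theorem exists_bound_of_forall_exists_isOpen {P : ℕ → X → Prop} (ho : ∀ n, IsOpen {x | P (n + 1) x})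
    (hP : ∀ x, ∃ n, P (n + 1) x) : ∃ L, ∀ x, ∃ n ≤ L, P n x := by
  obtain ⟨t, ht⟩ := isCompact_univ.elim_finite_subcover (fun n => {x | P (n + 1) x}) ho
    (fun x _ => Set.mem_iUnion.2 (hP x))
  refine ⟨t.sup id + 1, fun x => ?_⟩
  obtain ⟨n, hn, hx⟩ := Set.mem_iUnion₂.1 (ht (Set.mem_univ x))
  exact ⟨n + 1, Nat.succ_le_succ (Finset.le_sup (f := id) hn), hx⟩

/-- `T` is chain mixing: for every `δ > 0` some number of steps suffices to join any two points by
a `δ`-chain of exactly that length. -/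
def ChainMixing {X : Type u} [MetricSpace X] (T : X → X) : Prop :=
  ∀ δ : ℝ, 0 < δ → ∃ N : ℕ, 1 ≤ N ∧ ∀ x y : X, ∃ c : ℕ → X,
    c 0 = x ∧ c N = y ∧ ∀ i < N, dist (T (c i)) (c (i + 1)) ≤ δ

theorem HasCPE.exists_chainReach {T : C(X, X)} (hT : HasCPE T) {δ : ℝ} (hδ : 0 < δ) (x y : X) :
    ∃ n, ChainReach T δ (n + 1) x y := by
  have hU : (⋃ n, {y | ChainReach T δ (n + 1) x y}) = Set.univ := by
    refine hT.eq_univ_of_trapping (isOpen_iUnion fun n => isOpen_chainReach_right n x)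
      ⟨T x, Set.mem_iUnion.2 ⟨0, chainReach_one.2 (by simpa using hδ)⟩⟩ fun z hz => ?_
    -- A reachable `w` near `z` has `T w` within `δ` of `T z`, so one more jump lands exactly on `T
    -- z`: the reachable set is trapping.
    obtain ⟨w, hw, hwU⟩ := mem_closure_iff.1 hz _ (Metric.isOpen_ball.preimage T.continuous)
      (show z ∈ T ⁻¹' Metric.ball (T z) δ from Metric.mem_ball_self hδ)
    obtain ⟨n, hn⟩ := Set.mem_iUnion.1 hwU
    exact Set.mem_iUnion.2 ⟨n + 1, w, hn, hw⟩
  exact Set.mem_iUnion.1 (hU ▸ Set.mem_univ y)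

/-- Otherwise the length mod `g` of a chain from `x` to `y` would be a well-defined, locally
constant function of `y` that increases by 1 under `T`. -/
theorem HasCPE.setGcd_return_times {T : C(X, X)} (hT : HasCPE T) {δ : ℝ} (hδ : 0 < δ) (x : X) :
    Nat.setGcd {n | ChainReach T δ n x x} = 1 := by
  set s : Set ℕ := {n | ChainReach T δ n x x} with hs
  set g := Nat.setGcd s with hg
  have hg0 : g ≠ 0 := by
    intro h
    obtain ⟨n, hn⟩ := hT.exists_chainReach hδ x x
    have := Nat.setGcd_eq_zero_iff.1 h (show n + 1 ∈ s from hn)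
    simp at this
  by_contra hg1
  have hdvd : ∀ {n}, ChainReach T δ n x x → g ∣ n := fun h => Nat.setGcd_dvd_of_mem h
  -- Two chains to `y` are closed up by the same chain back to `x`, and `g` divides both totals.
  have huniq : ∀ {m n y}, ChainReach T δ m x y → ChainReach T δ n x y →
      (m : ZMod g) = (n : ZMod g) := by
    intro m n y hm hn
    obtain ⟨c, hc⟩ := hT.exists_chainReach hδ y x
    have h1 := (ZMod.natCast_eq_zero_iff _ _).2 (hdvd (hm.trans hc))
    have h2 := (ZMod.natCast_eq_zero_iff _ _).2 (hdvd (hn.trans hc))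
    rw [Nat.cast_add] at h1 h2
    exact add_right_cancel (h1.trans h2.symm)
  choose len hlen using hT.exists_chainReach hδ x
  have hκT : ∀ y n, ((len (T^[n] y) + 1 : ℕ) : ZMod g) = ((len y + 1 : ℕ) : ZMod g) + n := by
    intro y n
    rw [← Nat.cast_add]
    refine huniq (hlen _) ((hlen y).trans ?_)
    induction n with
    | zero => rfl
    | succ n ih =>
      refine ⟨_, ih, ?_⟩
      rw [Function.iterate_succ_apply', dist_self]
      exact hδ
  have : NeZero g := ⟨hg0⟩
  refine hT.not_factor_zmod (g := g) (by omega) (fun y => ((len y + 1 : ℕ) : ZMod g)) ?_ ?_ ?_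
  · refine continuous_discrete_rng.2 fun b => ?_
    have : (fun y => ((len y + 1 : ℕ) : ZMod g)) ⁻¹' {b} =
        ⋃ n ∈ {n : ℕ | ((n + 1 : ℕ) : ZMod g) = b}, {y | ChainReach T δ (n + 1) x y} := by
      ext y
      simp only [Set.mem_preimage, Set.mem_singleton_iff, Set.mem_iUnion, Set.mem_ofPred_eq,
        exists_prop]
      constructor
      · exact fun h => ⟨_, h, hlen y⟩
      · rintro ⟨n, hn, hr⟩
        rw [← hn]
        exact huniq (hlen y) hr
    rw [this]
    exact isOpen_biUnion fun n _ => isOpen_chainReach_right n x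
  · intro b
    refine ⟨T^[(b - ((len x + 1 : ℕ) : ZMod g)).val] x, ?_⟩
    simp only [hκT, ZMod.natCast_val, ZMod.cast_id', id_eq]
    ring
  · intro y
    simpa using hκT y 1

/-- Completely positive entropy implies chain mixing. -/
theorem HasCPE.chainMixing {T : C(X, X)} (hT : HasCPE T) : ChainMixing T := by
  intro δ hδ
  rcases isEmpty_or_nonempty X with hX | ⟨⟨x₀⟩⟩
  · exact ⟨1, le_rfl, fun x => (hX.false x).elim⟩
  set s : Set ℕ := {n | ChainReach T δ n x₀ x₀} with hs
  -- Return times form an additive monoid with gcd 1, so it contains every large integer.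
  obtain ⟨M, hM⟩ := Nat.exists_mem_closure_of_ge s
  have hclos : AddSubmonoid.closure s ≤
      { carrier := s, zero_mem' := rfl, add_mem' := fun h1 h2 => ChainReach.trans h1 h2 } :=
    AddSubmonoid.closure_le.2 subset_rfl
  have hloop : ∀ m ≥ M, ChainReach T δ m x₀ x₀ := fun m hm =>
    hclos (hM m hm (by rw [hT.setGcd_return_times hδ]; exact one_dvd _))
  obtain ⟨L₁, hL₁⟩ := exists_bound_of_forall_exists_isOpen
    (P := fun n x => ChainReach T δ n x x₀)
    (fun n => isOpen_chainReach_left T.continuous n x₀) fun x => hT.exists_chainReach hδ x x₀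
  obtain ⟨L₂, hL₂⟩ := exists_bound_of_forall_exists_isOpen
    (P := fun n y => ChainReach T δ n x₀ y)
    (fun n => isOpen_chainReach_right n x₀) fun y => hT.exists_chainReach hδ x₀ y
  refine ⟨M + L₁ + L₂ + 1, by omega, fun x y => ?_⟩
  obtain ⟨a, ha, hxa⟩ := hL₁ x
  obtain ⟨b, hb, hyb⟩ := hL₂ y
  -- The loop at `x₀` absorbs the difference in lengths, making the total independent of `x` and
  -- `y`.
  have h := (hxa.trans (hloop (M + L₁ + L₂ + 1 - a - b) (by omega))).trans hyb
  rw [show a + (M + L₁ + L₂ + 1 - a - b) + b = M + L₁ + L₂ + 1 by omega] at h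
  obtain ⟨c, h0, hn, hc⟩ := h.exists_seq
  exact ⟨c, h0, hn, fun i hi => (hc i hi).le⟩

end Chains

/-! ### Completely positive entropy from shadowing and chain mixing -/

section Independence

variable {X : Type u} [MetricSpace X]

/-- Under shadowing and chain mixing, any itinerary between two points can be followed along the
multiples of a fixed time. -/
theorem ChainMixing.exists_shadowed_itinerary {T : X → X} (hs : HasShadowing T)
    (hm : ChainMixing T) {ε : ℝ} (hε : 0 < ε) (p : Bool → X) :
    ∃ k, 1 ≤ k ∧ ∀ s : ℕ → Bool, ∃ y, ∀ i, dist (p (s i)) (T^[k * i] y) ≤ ε := by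
  obtain ⟨δ, hδ, hsh⟩ := hs ε hε
  obtain ⟨N, hN, hc⟩ := hm δ hδ
  choose c hc0 hcN hcs using hc
  refine ⟨N, hN, fun s => ?_⟩
  -- Concatenated chains of length `N`, with the prescribed points at the multiples of `N`.
  set z : ℕ → X := fun j => c (p (s (j / N))) (p (s (j / N + 1))) (j % N) with hz
  have hpo : IsPseudoOrbit T δ z := by
    intro j
    have hlt : j % N < N := Nat.mod_lt _ hN
    have hstep := hcs (p (s (j / N))) (p (s (j / N + 1))) (j % N) hlt
    rcases Nat.lt_or_ge (j % N + 1) N with h | h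
    · have hj : j + 1 = (j % N + 1) + N * (j / N) := by
        have := Nat.mod_add_div j N
        omega
      have h1 : (j + 1) / N = j / N := by
        rw [hj, Nat.add_mul_div_left _ _ hN, Nat.div_eq_of_lt h, zero_add]
      have h2 : (j + 1) % N = j % N + 1 := by
        rw [hj, Nat.add_mul_mod_self_left, Nat.mod_eq_of_lt h]
      simp only [hz, h1, h2]
      exact hstep
    · have hj : j + 1 = N * (j / N + 1) := by
        have := Nat.mod_add_div j N
        rw [mul_add, mul_one]
        omega
      have h1 : (j + 1) / N = j / N + 1 := by
        rw [hj, Nat.mul_div_cancel_left _ hN]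
      have h2 : (j + 1) % N = 0 := by
        rw [hj, Nat.mul_mod_right]
      simp only [hz, h1, h2, hc0]
      rwa [show j % N + 1 = N by omega, hcN] at hstep
  obtain ⟨y, hy⟩ := hsh z hpo
  refine ⟨y, fun i => ?_⟩
  have := hy (N * i)
  simp only [hz, Nat.mul_div_cancel_left i hN, Nat.mul_mod_right, hc0] at this
  exact this

/-- Shadowing and chain mixing imply completely positive entropy. -/
theorem ChainMixing.hasCPE {T : C(X, X)} (hs : HasShadowing T) (hm : ChainMixing T) :
    HasCPE T := by
  intro Y _ _ _ _ S φ hφ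
  obtain ⟨a, b, hab⟩ := exists_pair_ne Y
  obtain ⟨A, haA, hAc, B, hbB, hBc, hAB⟩ : ∃ A ∈ 𝓝 a, IsClosed A ∧ ∃ B ∈ 𝓝 b, IsClosed B ∧
      Disjoint A B := by
    obtain ⟨U, V, hU, hV, haU, hbV, hUV⟩ := t2_separation hab
    obtain ⟨A, hA, hAc, hAU⟩ := exists_mem_nhds_isClosed_subset (hU.mem_nhds haU)
    obtain ⟨B, hB, hBc, hBV⟩ := exists_mem_nhds_isClosed_subset (hV.mem_nhds hbV)
    exact ⟨A, hA, hAc, B, hB, hBc, hUV.mono hAU hBV⟩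
  obtain ⟨x, rfl⟩ := hφ.1 a
  obtain ⟨y, rfl⟩ := hφ.1 b
  obtain ⟨ε₁, hε₁, h1⟩ := Metric.nhds_basis_closedBall.mem_iff.1
    (φ.continuous.continuousAt.preimage_mem_nhds haA)
  obtain ⟨ε₂, hε₂, h2⟩ := Metric.nhds_basis_closedBall.mem_iff.1
    (φ.continuous.continuousAt.preimage_mem_nhds hbB)
  obtain ⟨k, hk, hit⟩ := hm.exists_shadowed_itinerary hs (lt_min hε₁ hε₂)
    (fun i => bif i then x else y)
  refine topEntropy_pos_of_independent S (fun i => bif i then A else B)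
    (by rintro (_ | _) <;> assumption) hAB hk fun s => ?_
  obtain ⟨z, hz⟩ := hit s
  refine ⟨φ z, fun i _ => ?_⟩
  rw [← (show Function.Semiconj φ T S from hφ.2).iterate_right (k * i) z]
  have hzi := hz i
  rw [dist_comm] at hzi
  cases hsi : s i
  · rw [hsi] at hzi
    exact h2 (Metric.mem_closedBall.2 (hzi.trans (min_le_right _ _)))
  · rw [hsi] at hzi
    exact h1 (Metric.mem_closedBall.2 (hzi.trans (min_le_left _ _)))

end Independence

/-! ### Borel complexity of shadowing and chain mixing -/

section Borel

variable {X : Type u} [MetricSpace X] [CompactSpace X]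

theorem continuous_iterate_apply (n : ℕ) : Continuous fun a : C(X, X) × X => a.1^[n] a.2 := by
  induction n with
  | zero => exact continuous_snd
  | succ n ih =>
    simp only [Function.iterate_succ_apply']
    exact continuous_fst.eval ih

theorem isClosed_exists_of_compactSpace {A B : Type*} [TopologicalSpace A] [TopologicalSpace B]
    [CompactSpace B] {P : A → B → Prop} (h : IsClosed {q : A × B | P q.1 q.2}) :
    IsClosed {a | ∃ b, P a b} := by
  convert isClosedMap_fst_of_compactSpace _ h using 1
  ext a
  simp

/-- Every strict `δ`-pseudo-orbit is `ε`-shadowed up to time `n`. -/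
def FiniteShadowing (ε δ : ℝ) (n : ℕ) (T : X → X) : Prop :=
  ∀ x : ℕ → X, (∀ i < n, dist (T (x i)) (x (i + 1)) < δ) →
    ∃ y, ∀ i ≤ n, dist (x i) (T^[i] y) ≤ ε

/-- For a fixed sequence the strict hypothesis is open in `T`, and the conclusion is closed by
compactness of `X`; hence the implication is a closed condition. -/
theorem isClosed_finiteShadowing (ε δ : ℝ) (n : ℕ) :
    IsClosed {T : C(X, X) | FiniteShadowing ε δ n T} := by
  have : {T : C(X, X) | FiniteShadowing ε δ n T} = ⋂ x : ℕ → X,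
      {T : C(X, X) | ∀ i < n, dist (T (x i)) (x (i + 1)) < δ}ᶜ ∪
        {T : C(X, X) | ∃ y, ∀ i ≤ n, dist (x i) (T^[i] y) ≤ ε} := by
    ext T
    simp only [FiniteShadowing, Set.mem_ofPred_eq, Set.mem_iInter, Set.mem_union,
      Set.mem_compl_iff, imp_iff_not_or]
  rw [this]
  refine isClosed_iInter fun x => IsClosed.union (IsOpen.isClosed_compl ?_) ?_
  · have : {T : C(X, X) | ∀ i < n, dist (T (x i)) (x (i + 1)) < δ} =
        ⋂ i ∈ Set.Iio n, {T | dist (T (x i)) (x (i + 1)) < δ} := by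
      ext T
      simp
    rw [this]
    exact (Set.finite_Iio n).isOpen_biInter fun i _ =>
      isOpen_lt ((continuous_eval_const (x i)).dist continuous_const)
        continuous_const
  · refine isClosed_exists_of_compactSpace (P := fun (T : C(X, X)) y =>
      ∀ i ≤ n, dist (x i) (T^[i] y) ≤ ε) ?_
    simp only [Set.ofPred_forall]
    exact isClosed_iInter fun i => isClosed_iInter fun _ =>
      isClosed_le (continuous_const.dist (continuous_iterate_apply i)) continuous_const

theorem hasShadowing_iff {T : C(X, X)} :
    HasShadowing T ↔ ∀ j : ℕ, ∃ k : ℕ, ∀ n,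
      FiniteShadowing (1 / ((j : ℝ) + 1)) (1 / ((k : ℝ) + 1)) n T := by
  constructor
  · intro h j
    obtain ⟨δ, hδ, hsh⟩ := h (1 / ((j : ℝ) + 1)) (by positivity)
    obtain ⟨k, hk⟩ := exists_nat_one_div_lt hδ
    refine ⟨k, fun n x hx => ?_⟩
    -- The finite pseudo-orbit is continued by the true orbit of its last point.
    obtain ⟨y, hy⟩ := hsh (fun i => if i ≤ n then x i else T^[i - n] (x n)) fun i => by
      rcases lt_trichotomy i n with hi | rfl | hi
      · simpa [hi.le, Nat.succ_le_of_lt hi] using ((hx i hi).trans hk).le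
      · simpa using hδ.le
      · have h1 : ¬ i ≤ n := by omega
        have h2 : ¬ i + 1 ≤ n := by omega
        simp only [h1, h2, if_false]
        rw [Nat.sub_add_comm hi.le, Function.iterate_succ_apply', dist_self]
        exact hδ.le
    refine ⟨y, fun i hi => ?_⟩
    simpa [hi] using hy i
  · intro h ε hε
    obtain ⟨j, hj⟩ := exists_nat_one_div_lt hε
    obtain ⟨k, hk⟩ := h j
    -- Halving turns the non-strict bound of a pseudo-orbit into the strict one of
    -- `FiniteShadowing`. A point that shadows for all time then comes from a nested intersection of
    -- compact sets.
    refine ⟨1 / ((k : ℝ) + 1) / 2, by positivity, fun x hx => ?_⟩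
    have hclosed : ∀ n, IsClosed {y | ∀ i ≤ n, dist (x i) (T^[i] y) ≤ 1 / ((j : ℝ) + 1)} := by
      intro n
      simp only [Set.ofPred_forall]
      exact isClosed_iInter fun i => isClosed_iInter fun _ =>
        isClosed_le (continuous_const.dist (T.continuous.iterate i)) continuous_const
    obtain ⟨y, hy⟩ := IsCompact.nonempty_iInter_of_sequence_nonempty_isCompact_isClosed
      (fun n => {y | ∀ i ≤ n, dist (x i) (T^[i] y) ≤ 1 / ((j : ℝ) + 1)})
      (fun n y hy i hi => hy i (by omega))
      (fun n => hk n x fun i _ => (hx i).trans_lt (half_lt_self (by positivity)))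
      (hclosed 0).isCompact hclosed
    exact ⟨y, fun n => (Set.mem_iInter.1 hy n n le_rfl).trans hj.le⟩

/-- The sequence space `ℕ → X` is compact, so projecting the closed chain condition along it
preserves closedness. -/
theorem isClosed_joined_by_chains (δ : ℝ) (N : ℕ) :
    IsClosed {T : C(X, X) | ∀ x y : X, ∃ c : ℕ → X,
      c 0 = x ∧ c N = y ∧ ∀ i < N, dist (T (c i)) (c (i + 1)) ≤ δ} := by
  simp only [Set.ofPred_forall]
  refine isClosed_iInter fun x => isClosed_iInter fun y =>
    isClosed_exists_of_compactSpace (P := fun (T : C(X, X)) (c : ℕ → X) =>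
      c 0 = x ∧ c N = y ∧ ∀ i < N, dist (T (c i)) (c (i + 1)) ≤ δ) ?_
  have hev : ∀ i : ℕ, Continuous fun q : C(X, X) × (ℕ → X) => q.2 i := fun i =>
    (continuous_apply i).comp continuous_snd
  have hsteps : IsClosed {q : C(X, X) × (ℕ → X) |
      ∀ i < N, dist (q.1 (q.2 i)) (q.2 (i + 1)) ≤ δ} := by
    simp only [Set.ofPred_forall]
    exact isClosed_iInter fun i => isClosed_iInter fun _ =>
      isClosed_le ((continuous_fst.eval (hev i)).dist (hev (i + 1))) continuous_const
  exact (isClosed_eq (hev 0) continuous_const).inter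
    ((isClosed_eq (hev N) continuous_const).inter hsteps)

omit [CompactSpace X] in
theorem chainMixing_iff {T : X → X} :
    ChainMixing T ↔ ∀ k : ℕ, ∃ N : ℕ, 1 ≤ N ∧ ∀ x y : X, ∃ c : ℕ → X,
      c 0 = x ∧ c N = y ∧ ∀ i < N, dist (T (c i)) (c (i + 1)) ≤ 1 / ((k : ℝ) + 1) := by
  constructor
  · exact fun h k => h _ (by positivity)
  · intro h δ hδ
    obtain ⟨k, hk⟩ := exists_nat_one_div_lt hδ
    obtain ⟨N, hN, hc⟩ := h k
    refine ⟨N, hN, fun x y => ?_⟩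
    obtain ⟨c, h0, h1, h2⟩ := hc x y
    exact ⟨c, h0, h1, fun i hi => (h2 i hi).trans hk.le⟩

theorem shad_inter_CPE_eq :
    Shad X ∩ CPE X = Shad X ∩ {T : C(X, X) | ChainMixing T} := by
  ext T
  exact ⟨fun h => ⟨h.1, HasCPE.chainMixing h.2⟩, fun h => ⟨h.1, ChainMixing.hasCPE h.1 h.2⟩⟩

theorem measurableSet_shad : @MeasurableSet C(X, X) (borel C(X, X)) (Shad X) := by
  borelize C(X, X)
  have : Shad X = ⋂ j : ℕ, ⋃ k : ℕ, ⋂ n : ℕ,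
      {T : C(X, X) | FiniteShadowing (1 / ((j : ℝ) + 1)) (1 / ((k : ℝ) + 1)) n T} := by
    ext T
    simp only [Shad, Set.mem_ofPred_eq, hasShadowing_iff, Set.mem_iInter, Set.mem_iUnion]
  rw [this]
  exact MeasurableSet.iInter fun j => MeasurableSet.iUnion fun k => MeasurableSet.iInter fun n =>
    (isClosed_finiteShadowing _ _ n).measurableSet

theorem measurableSet_chainMixing :
    @MeasurableSet C(X, X) (borel C(X, X)) {T : C(X, X) | ChainMixing T} := by
  borelize C(X, X)
  have : {T : C(X, X) | ChainMixing T} = ⋂ k : ℕ, ⋃ N : ℕ, ⋃ _ : 1 ≤ N,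
      {T : C(X, X) | ∀ x y : X, ∃ c : ℕ → X, c 0 = x ∧ c N = y ∧
        ∀ i < N, dist (T (c i)) (c (i + 1)) ≤ 1 / ((k : ℝ) + 1)} := by
    ext T
    simp only [Set.mem_ofPred_eq, chainMixing_iff, Set.mem_iInter, Set.mem_iUnion, exists_prop]
  rw [this]
  exact MeasurableSet.iInter fun k => MeasurableSet.iUnion fun N => MeasurableSet.iUnion fun _ =>
    (isClosed_joined_by_chains _ N).measurableSet

end Borel

end LocalEntropy

theorem mainTheorem3 {X : Type*} [MetricSpace X] [CompactSpace X] :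
    @MeasurableSet C(X, X) (borel C(X, X)) (LocalEntropy.Shad X ∩ LocalEntropy.CPE X) := by
  rw [LocalEntropy.shad_inter_CPE_eq]
  exact @MeasurableSet.inter _ (borel C(X, X)) _ _ LocalEntropy.measurableSet_shad
    LocalEntropy.measurableSet_chainMixing
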